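/- Let $\mathcal M=B(\ell^2)$ with its canonical trace $\mathrm{Tr}$, and let $(\mathcal A,\tau)$ be a noncommutative probability space (a von Neumann algebra with a faithful normal tracial state). Let $(\xi_i)_{i\ge 0}$ be a sequence in $\mathcal A$ that is either a sequence of $*$-free Haar unitaries, or a sequence of independent Rademacher variables (the $\xi_i$ commute, are independent with respect to $\tau$, and each is self-adjoint with distribution $\tfrac12(\delta_1+\delta_{-1})$). For a von Neumann algebra $\mathcal N$ with trace $\mathrm{tr}$ and $T\in\mathcal N$ put $$\mu_t(T)=\inf\{\|eT\| : e\in\mathcal N \text{ a projection},\ \mathrm{tr}(1-e)\le t\},\qquad \|T\|_{2,\infty}=\sup_{t>0}t^{1/2}\mu_t(T).$$ For a finite sequence $x=(x_n)_{n\ge0}$ of finite-rank operators on $\ell^2$, put $$\|x\|_{R_{2,\infty}}=\Big\|\sum_n x_n\otimes e_{0,n}\Big\|_{2,\infty},\qquad \|x\|_{C_{2,\infty}}=\Big\|\sum_n x_n\otimes e_{n,0}\Big\|_{2,\infty},$$ computed in $\mathcal M\overline\otimes B(\ell^2)$ with trace $\mathrm{Tr}\otimes\mathrm{Tr}$, where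 the $e_{m,n}$ are the matrix units. Let $\|x\|_{R_{2,\infty}\cap C_{2,\infty}}$ be the maximum of these two quantities, and let $$\|x\|_{R_{2,\infty}+C_{2,\infty}}=\inf\{\|y\|_{R_{2,\infty}}+\|z\|_{C_{2,\infty}}: x=y+z\},$$ where $y,z$ range over finite sequences of finite-rank operators. Finally, $\|\sum_i x_i\otimes\xi_i\|_{2,\infty}$ is computed in $\mathcal M\overline\otimes\mathcal A$ with trace $\mathrm{Tr}\otimes\tau$. Then: 1. There is no constant $c<\infty$ such that, for every finite sequence $x$ of finite-rank operators on $\ell^2$, $$\Big\|\sum_{i\ge0}x_i\otimes\xi_i\Big\|_{2,\infty}\le c\,\|x\|_{R_{2,\infty}+C_{2,\infty}}.$$ 2. There is no constant $c<\infty$ such that, for every finite sequence $x$ of finite-rank operators on $\ell^2$, $$\|x\|_{R_{2,\infty}\cap C_{2,\infty}}\le c\,\Big\|\sum_{i\ge0}x_i\otimes\xi_i\Big\|_{2,\infty}.$$ -/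

import Mathlib

open scoped ENNReal NNReal TensorProduct

set_option linter.unusedSectionVars false

noncomputable section

namespace NCKhintchine

universe u

/-! ### Von Neumann algebras generated by a set of operators -/

section Generated

variable {K : Type u} [NormedAddCommGroup K] [InnerProductSpace ℂ K] [CompleteSpace K]

/-- The von Neumann algebra `(S ∪ S*)''` generated by a set `S` of bounded operators. -/
def generatedVNA (S : Set (K →L[ℂ] K)) : VonNeumannAlgebra K where
  toStarSubalgebra :=
    StarSubalgebra.centralizer ℂ (StarSubalgebra.centralizer ℂ S : Set (K →L[ℂ] K))
  centralizer_centralizer' := by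
    have h : (star (StarSubalgebra.centralizer ℂ S : Set (K →L[ℂ] K)))
        = (StarSubalgebra.centralizer ℂ S : Set (K →L[ℂ] K)) := by
      ext x
      simp only [Set.mem_star, SetLike.mem_coe]
      exact star_mem_iff
    change Set.centralizer (Set.centralizer (StarSubalgebra.centralizer ℂ
      (StarSubalgebra.centralizer ℂ S : Set (K →L[ℂ] K)) : Set (K →L[ℂ] K)))
      = (StarSubalgebra.centralizer ℂ
      (StarSubalgebra.centralizer ℂ S : Set (K →L[ℂ] K)) : Set (K →L[ℂ] K))
    rw [StarSubalgebra.coe_centralizer, h, Set.union_self, Set.centralizer_centralizer_centralizer]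

theorem mem_generatedVNA {S : Set (K →L[ℂ] K)} {T : K →L[ℂ] K} (hT : T ∈ S) :
    T ∈ (generatedVNA S).toStarSubalgebra := by
  change T ∈ StarSubalgebra.centralizer ℂ (StarSubalgebra.centralizer ℂ S : Set (K →L[ℂ] K))
  rw [StarSubalgebra.mem_centralizer_iff]
  intro g hg
  have key : ∀ g ∈ StarSubalgebra.centralizer ℂ S, g * T = T * g := fun g hg =>
    ((StarSubalgebra.mem_centralizer_iff ℂ).1 hg T hT).1.symm
  exact ⟨key g hg, key _ (star_mem hg)⟩

theorem commute_of_mem_generatedVNA {S : Set (K →L[ℂ] K)} {T b : K →L[ℂ] K}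
    (hT : T ∈ (generatedVNA S).toStarSubalgebra)
    (hb : ∀ g ∈ S, g * b = b * g ∧ star g * b = b * star g) : b * T = T * b :=
  ((StarSubalgebra.mem_centralizer_iff ℂ).1 hT b
    ((StarSubalgebra.mem_centralizer_iff ℂ).2 hb)).1

end Generated

/-! ### Generalised singular numbers and weak `L_p` quasi-norms -/

/-- A von Neumann algebra together with a `[0,∞]`-valued function, thought of as a trace on its
positive part (only the values at positive elements are relevant). This is bare data; it is only
used for the algebras constructed below. -/
structure WeightedVNA (K : Type u) [NormedAddCommGroup K] [InnerProductSpace ℂ K]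
    [CompleteSpace K] where
  alg : VonNeumannAlgebra K
  tr : alg.toStarSubalgebra → ℝ≥0∞

/-- The elements of the algebra. -/
abbrev WeightedVNA.Elem {K : Type u} [NormedAddCommGroup K] [InnerProductSpace ℂ K]
    [CompleteSpace K] (N : WeightedVNA K) : Type u := N.alg.toStarSubalgebra

section SingularNumbers

variable {K : Type u} [NormedAddCommGroup K] [InnerProductSpace ℂ K] [CompleteSpace K]

/-- Generalised singular numbers
`μ_t(T) = inf {‖eT‖ : e a projection of the algebra with tr(1 - e) ≤ t}`. -/
def singularNumber (N : WeightedVNA K) (T : N.Elem) (t : ℝ≥0) : ℝ≥0∞ :=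
  ⨅ (e : N.Elem) (_ : IsStarProjection e) (_ : N.tr (1 - e) ≤ t),
    ‖((e * T : N.Elem) : K →L[ℂ] K)‖ₑ

/-- The weak `L_p` quasi-norm `‖T‖_{p,∞} = sup_{t ≥ 0} t^{1/p} μ_t(T)`. -/
def weakNorm (p : ℝ) (N : WeightedVNA K) (T : N.Elem) : ℝ≥0∞ :=
  ⨆ t : ℝ≥0, (t : ℝ≥0∞) ^ (1 / p) * singularNumber N T t

end SingularNumbers

/-! ### The algebra `B(ℓ²)` with its canonical trace -/

/-- The Hilbert space `ℓ²(ℕ, ℂ)`. -/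
abbrev Ell2 : Type := lp (fun _ : ℕ => ℂ) 2

/-- The canonical orthonormal basis of `ℓ²`. -/
def basisVec (n : ℕ) : Ell2 := lp.single 2 n (1 : ℂ)

/-- The matrix unit `e_{m,n}`, i.e. `v ↦ ⟪e_n, v⟫ e_m`. -/
def matrixUnit (m n : ℕ) : Ell2 →L[ℂ] Ell2 :=
  InnerProductSpace.rankOne ℂ (basisVec m) (basisVec n)

/-- `B(ℓ²)`, the algebra of all bounded operators, with the canonical trace
`Tr T = ∑ₙ ⟪e_n, T e_n⟫` for `T ≥ 0`. -/
def BEll2 : WeightedVNA Ell2 where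
  alg :=
    { toStarSubalgebra := ⊤
      centralizer_centralizer' := by
        apply Set.eq_univ_of_forall
        intro x y hy
        exact (hy x (Set.mem_univ x)).symm }
  tr T := ∑' n, ENNReal.ofReal
    (inner ℂ (basisVec n) ((T : Ell2 →L[ℂ] Ell2) (basisVec n))).re

/-- A bounded operator on `ℓ²` as an element of the algebra `B(ℓ²)`. -/
def toBEll2 (x : Ell2 →L[ℂ] Ell2) : BEll2.Elem := ⟨x, trivial⟩

/-! ### The tensor product `B(ℓ²) ⊗̄ N` with the tensor product trace -/

section Tensor

variable {H : Type u} [NormedAddCommGroup H] [InnerProductSpace ℂ H] [CompleteSpace H]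

/-- The Hilbert space tensor product `ℓ² ⊗ H` (completed). -/
abbrev Ell2Tensor (H : Type u) [NormedAddCommGroup H] [InnerProductSpace ℂ H] : Type u :=
  UniformSpace.Completion (Ell2 ⊗[ℂ] H)

/-- The operator `x ⊗ a` on `ℓ² ⊗ H`, with `(x ⊗ a)(v ⊗ h) = x v ⊗ a h`. -/
def opTensor (x : Ell2 →L[ℂ] Ell2) (a : H →L[ℂ] H) : Ell2Tensor H →L[ℂ] Ell2Tensor H :=
  (TensorProduct.mapL x a).completion

/-- The isometry `H → ℓ² ⊗ H`, `h ↦ e_n ⊗ h`. -/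
def slot (H : Type u) [NormedAddCommGroup H] [InnerProductSpace ℂ H] (n : ℕ) :
    H →L[ℂ] Ell2Tensor H :=
  UniformSpace.Completion.toComplL ∘L TensorProduct.mkL ℂ Ell2 H (basisVec n)

/-- The operator entry `T_{m,n} = V_m* T V_n` of an operator `T` on `ℓ² ⊗ H`, where
`V_n h = e_n ⊗ h`. -/
def opEntry (T : Ell2Tensor H →L[ℂ] Ell2Tensor H) (m n : ℕ) : H →L[ℂ] H :=
  (ContinuousLinearMap.adjoint (slot H m)) ∘L T ∘L slot H n

theorem slot_apply (n : ℕ) (h : H) :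
    slot H n h = ((basisVec n ⊗ₜ[ℂ] h : Ell2 ⊗[ℂ] H) : Ell2Tensor H) := rfl

theorem opTensor_coe (x : Ell2 →L[ℂ] Ell2) (a : H →L[ℂ] H) (z : Ell2 ⊗[ℂ] H) :
    opTensor x a (z : Ell2Tensor H) = ((TensorProduct.mapL x a z : Ell2 ⊗[ℂ] H) : Ell2Tensor H) :=
  UniformSpace.Completion.map_coe (TensorProduct.mapL x a).uniformContinuous z

theorem opTensor_mul (x y : Ell2 →L[ℂ] Ell2) (a b : H →L[ℂ] H) :
    opTensor x a * opTensor y b = opTensor (x * y) (a * b) := by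
  ext z
  induction z using UniformSpace.Completion.induction_on with
  | hp => exact isClosed_eq (by fun_prop) (by fun_prop)
  | ih z =>
    rw [mul_apply_eq_comp, opTensor_coe, opTensor_coe, opTensor_coe,
      TensorProduct.mapL_mul]
    rfl

theorem inner_mapL (x : Ell2 →L[ℂ] Ell2) (a : H →L[ℂ] H) (z w : Ell2 ⊗[ℂ] H) :
    inner ℂ (TensorProduct.mapL x a z) w = inner ℂ z (TensorProduct.mapL (star x) (star a) w) := by
  induction z using TensorProduct.induction_on with
  | zero => simp
  | add z₁ z₂ h₁ h₂ => rw [map_add, inner_add_left, inner_add_left, h₁, h₂]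
  | tmul v h =>
    induction w using TensorProduct.induction_on with
    | zero => simp
    | add w₁ w₂ h₁ h₂ => rw [map_add, inner_add_right, inner_add_right, h₁, h₂]
    | tmul v' h' =>
      rw [TensorProduct.mapL_tmul, TensorProduct.mapL_tmul, TensorProduct.inner_tmul,
        TensorProduct.inner_tmul, ContinuousLinearMap.star_eq_adjoint,
        ContinuousLinearMap.star_eq_adjoint, ContinuousLinearMap.adjoint_inner_right,
        ContinuousLinearMap.adjoint_inner_right]

theorem star_opTensor (x : Ell2 →L[ℂ] Ell2) (a : H →L[ℂ] H) :
    star (opTensor x a) = opTensor (star x) (star a) := by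
  rw [ContinuousLinearMap.star_eq_adjoint]
  symm
  rw [ContinuousLinearMap.eq_adjoint_iff]
  intro z w
  induction z, w using UniformSpace.Completion.induction_on₂ with
  | hp => exact isClosed_eq (by fun_prop) (by fun_prop)
  | ih z w =>
    rw [opTensor_coe, opTensor_coe, UniformSpace.Completion.inner_coe,
      UniformSpace.Completion.inner_coe, inner_mapL, star_star, star_star]

theorem opTensor_one_slot (b : H →L[ℂ] H) (n : ℕ) :
    opTensor 1 b ∘L slot H n = slot H n ∘L b := by
  ext h
  rw [ContinuousLinearMap.comp_apply, ContinuousLinearMap.comp_apply, slot_apply, opTensor_coe,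
    slot_apply, TensorProduct.mapL_tmul]
  rfl

theorem adjoint_slot_opTensor_one (b : H →L[ℂ] H) (m : ℕ) :
    ContinuousLinearMap.adjoint (slot H m) ∘L opTensor 1 b
      = b ∘L ContinuousLinearMap.adjoint (slot H m) := by
  have h := congrArg ContinuousLinearMap.adjoint (opTensor_one_slot (star b) m)
  rw [ContinuousLinearMap.adjoint_comp, ContinuousLinearMap.adjoint_comp,
    ← ContinuousLinearMap.star_eq_adjoint (opTensor 1 (star b)), star_opTensor,
    ← ContinuousLinearMap.star_eq_adjoint (star b), star_star, star_one] at h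
  exact h

/-- The von Neumann algebra `B(ℓ²) ⊗̄ A` on `ℓ² ⊗ H`: it is generated by the operators `x ⊗ a`
with `x ∈ B(ℓ²)` and `a ∈ A`. -/
def tensorVNA (A : VonNeumannAlgebra H) : VonNeumannAlgebra (Ell2Tensor H) :=
  generatedVNA {T | ∃ (x : Ell2 →L[ℂ] Ell2) (a : H →L[ℂ] H), a ∈ A ∧ T = opTensor x a}

/-- The entries of an element of `B(ℓ²) ⊗̄ A` belong to `A`. -/
theorem opEntry_mem (A : VonNeumannAlgebra H) {T : Ell2Tensor H →L[ℂ] Ell2Tensor H}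
    (hT : T ∈ (tensorVNA A).toStarSubalgebra) (m n : ℕ) :
    opEntry T m n ∈ A.toStarSubalgebra := by
  rw [VonNeumannAlgebra.mem_carrier, ← A.centralizer_centralizer]
  intro b hb
  have hcomm : opTensor 1 b * T = T * opTensor 1 b := by
    apply commute_of_mem_generatedVNA hT
    rintro g ⟨x, a, ha, rfl⟩
    rw [star_opTensor]
    simp only [opTensor_mul, one_mul, mul_one]
    exact ⟨by rw [hb a ha], by rw [hb (star a) (star_mem (S := VonNeumannAlgebra H) ha)]⟩
  change b ∘L (ContinuousLinearMap.adjoint (slot H m) ∘L T ∘L slot H n)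
    = (ContinuousLinearMap.adjoint (slot H m) ∘L T ∘L slot H n) ∘L b
  change opTensor 1 b ∘L T = T ∘L opTensor 1 b at hcomm
  rw [← ContinuousLinearMap.comp_assoc, ← adjoint_slot_opTensor_one,
    ContinuousLinearMap.comp_assoc, ← ContinuousLinearMap.comp_assoc (opTensor 1 b), hcomm,
    ContinuousLinearMap.comp_assoc, opTensor_one_slot]
  simp only [ContinuousLinearMap.comp_assoc]

/-- `B(ℓ²) ⊗̄ N` with the tensor product trace: `(Tr ⊗ tr)(T) = ∑ₙ tr(T_{n,n})` for `T ≥ 0`. -/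
def tensorAlg (N : WeightedVNA H) : WeightedVNA (Ell2Tensor H) where
  alg := tensorVNA N.alg
  tr T := ∑' n, N.tr ⟨opEntry (T : Ell2Tensor H →L[ℂ] Ell2Tensor H) n n, opEntry_mem N.alg T.2 n n⟩

/-- The elementary tensor `x ⊗ a` as an element of `B(ℓ²) ⊗̄ N`. -/
def elemTensor {N : WeightedVNA H} (x : Ell2 →L[ℂ] Ell2) (a : N.Elem) : (tensorAlg N).Elem :=
  ⟨opTensor x (a : H →L[ℂ] H), mem_generatedVNA ⟨x, a, a.2, rfl⟩⟩

end Tensor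

/-! ### Noncommutative probability spaces, free Haar unitaries and Rademacher variables -/

open scoped ComplexOrder in
/-- A noncommutative probability space: a von Neumann algebra with a faithful normal tracial
state. -/
structure NCProbSpace (H : Type u) [NormedAddCommGroup H] [InnerProductSpace ℂ H]
    [CompleteSpace H] where
  alg : VonNeumannAlgebra H
  τ : alg.toStarSubalgebra →ₗ[ℂ] ℂ
  map_one : τ 1 = 1
  nonneg : ∀ a, 0 ≤ τ (star a * a)
  faithful : ∀ a, τ (star a * a) = 0 → a = 0
  tracial : ∀ a b, τ (a * b) = τ (b * a)
  /-- `τ (sup S) = sup τ(S)` for bounded increasing nets of positive elements. -/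
  normal : ∀ S : Set alg.toStarSubalgebra, S.Nonempty → DirectedOn (· ≤ ·) S →
    (∀ s ∈ S, 0 ≤ s) → ∀ a, IsLUB S a → IsLUB ((fun s => (τ s).re) '' S) (τ a).re

namespace NCProbSpace

variable {H : Type u} [NormedAddCommGroup H] [InnerProductSpace ℂ H] [CompleteSpace H]
variable (A : NCProbSpace H)

/-- The elements of the algebra of a noncommutative probability space. -/
abbrev Elem : Type u := A.alg.toStarSubalgebra

/-- The underlying algebra, with the trace viewed as a `[0,∞]`-valued function on the positive
part. -/
def toWeighted : WeightedVNA H where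
  alg := A.alg
  tr a := ENNReal.ofReal (A.τ a).re

/-- The unital star-subalgebra generated by one element. -/
def generatedBy (a : A.Elem) : StarSubalgebra ℂ A.Elem := StarAlgebra.adjoin ℂ {a}

/-- Freeness of the unital star-algebras generated by the `ξ i`: alternating products of centred
elements are centred. -/
def IsStarFree (ξ : ℕ → A.Elem) : Prop :=
  ∀ l : List (ℕ × A.Elem), l ≠ [] → l.IsChain (fun p q => p.1 ≠ q.1) →
    (∀ p ∈ l, p.2 ∈ A.generatedBy (ξ p.1) ∧ A.τ p.2 = 0) → A.τ (l.map Prod.snd).prod = 0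

/-- A Haar unitary: a unitary all of whose nonzero integer powers have trace zero. -/
def IsHaarUnitary (u : A.Elem) : Prop :=
  u ∈ unitary A.Elem ∧ ∀ n : ℕ, 0 < n → A.τ (u ^ n) = 0 ∧ A.τ (star u ^ n) = 0

/-- A sequence of free Haar unitaries. -/
def IsFreeHaar (ξ : ℕ → A.Elem) : Prop :=
  (∀ i, A.IsHaarUnitary (ξ i)) ∧ A.IsStarFree ξ

/-- Independence in the classical (commutative) sense of the algebras generated by the `ξ i`:
they commute with each other, and the trace is multiplicative on products of elements taken from
algebras with distinct indices. -/
def IsClassicallyIndependent (ξ : ℕ → A.Elem) : Prop :=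
  (∀ i j, i ≠ j → ∀ a ∈ A.generatedBy (ξ i), ∀ b ∈ A.generatedBy (ξ j), a * b = b * a) ∧
  ∀ l : List (ℕ × A.Elem), (l.map Prod.fst).Nodup →
    (∀ p ∈ l, p.2 ∈ A.generatedBy (ξ p.1)) →
    A.τ (l.map Prod.snd).prod = (l.map fun p => A.τ p.2).prod

/-- A symmetric sign: a self-adjoint element with square `1` and trace `0`. Equivalently, a
self-adjoint element whose distribution with respect to the trace is `(δ₁ + δ₋₁)/2`. -/
def IsSymmetricSign (a : A.Elem) : Prop :=
  IsSelfAdjoint a ∧ a * a = 1 ∧ A.τ a = 0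

/-- A sequence of (independent) Rademacher variables. For `A = L^∞(Ω, P)` acting on `L²(Ω, P)`
with `τ` the expectation, these are exactly the independent random variables taking the values
`1` and `-1` with probability `1/2` each. -/
def IsRademacher (ξ : ℕ → A.Elem) : Prop :=
  (∀ i, A.IsSymmetricSign (ξ i)) ∧ A.IsClassicallyIndependent ξ

end NCProbSpace

/-! ### Finite sequences in `B(ℓ²)` and their norms -/

/-- Finite sequences `(x₀, x₁, …)` of operators on `ℓ²` (all but finitely many terms are zero). -/
abbrev FinSeq : Type := ℕ →₀ (Ell2 →L[ℂ] Ell2)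

/-- All terms of the sequence have finite rank, i.e. their supports have finite trace. -/
def FinSeq.FiniteRank (x : FinSeq) : Prop :=
  ∀ n, FiniteDimensional ℂ (x n).range

/-- `Rx = ∑ₙ xₙ ⊗ e_{0,n}` in `B(ℓ²) ⊗̄ B(ℓ²)`. -/
def rowOp (x : FinSeq) : (tensorAlg BEll2).Elem :=
  x.sum fun n y => elemTensor y (toBEll2 (matrixUnit 0 n))

/-- `Cx = ∑ₙ xₙ ⊗ e_{n,0}` in `B(ℓ²) ⊗̄ B(ℓ²)`. -/
def colOp (x : FinSeq) : (tensorAlg BEll2).Elem :=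
  x.sum fun n y => elemTensor y (toBEll2 (matrixUnit n 0))

/-- `Gx = ∑ₙ xₙ ⊗ ξₙ` in `B(ℓ²) ⊗̄ A`. -/
def averageOp {H : Type u} [NormedAddCommGroup H] [InnerProductSpace ℂ H] [CompleteSpace H]
    (A : NCProbSpace H) (ξ : ℕ → A.Elem) (x : FinSeq) : (tensorAlg A.toWeighted).Elem :=
  x.sum fun n y => elemTensor (N := A.toWeighted) y (ξ n)

/-- `‖x‖_{R_{p,∞}} = ‖Rx‖_{p,∞}`. -/
def rowNorm (p : ℝ) (x : FinSeq) : ℝ≥0∞ := weakNorm p (tensorAlg BEll2) (rowOp x)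

/-- `‖x‖_{C_{p,∞}} = ‖Cx‖_{p,∞}`. -/
def colNorm (p : ℝ) (x : FinSeq) : ℝ≥0∞ := weakNorm p (tensorAlg BEll2) (colOp x)

/-- `‖x‖_{R_{p,∞} + C_{p,∞}}`: the infimum of `‖y‖_{R_{p,∞}} + ‖z‖_{C_{p,∞}}` over decompositions
`x = y + z` into finite sequences of finite rank operators. -/
def sumNorm (p : ℝ) (x : FinSeq) : ℝ≥0∞ :=
  ⨅ (y : FinSeq) (z : FinSeq) (_ : y.FiniteRank) (_ : z.FiniteRank) (_ : y + z = x),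
    rowNorm p y + colNorm p z

/-- `‖x‖_{R_{p,∞} ∩ C_{p,∞}}`. -/
def interNorm (p : ℝ) (x : FinSeq) : ℝ≥0∞ := max (rowNorm p x) (colNorm p x)

/-- `‖∑ₙ xₙ ⊗ ξₙ‖_{p,∞}`. -/
def averageNorm {H : Type u} [NormedAddCommGroup H] [InnerProductSpace ℂ H] [CompleteSpace H]
    (p : ℝ) (A : NCProbSpace H) (ξ : ℕ → A.Elem) (x : FinSeq) : ℝ≥0∞ :=
  weakNorm p (tensorAlg A.toWeighted) (averageOp A ξ x)

end NCKhintchine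

end

noncomputable section

namespace NCKhintchine

universe u

/-! ### Sums of mutually orthogonal projections -/

section Projections

/-! Everything about `ξ` enters through `ξ i * star (ξ i) = 1`, which holds in both cases. For `xᵢ =
sᵢ e_{j(i),i}` and `T = ∑ xᵢ ⊗ aᵢ`, the cross terms of `T T*` vanish, so `T T* = ∑ sᵢ² e_{j(i),j(i)}
⊗ aᵢ aᵢ*` (`unitSeqOp_mul_star`). With `aᵢ = e_{i,0}` (column), the weights `sᵢ²` sit on mutually
orthogonal rank-one projections. With `aᵢ = ξᵢ` (average), all weights with `j(i) = k` pile up on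
the single trace-one projection `e_{k,k} ⊗ 1`. The weak quasi-norm is at most 1 when the weights are
bounded by `1/(k+1)`, although their sum, the harmonic sum `h_n = 1 + 1/2 + ... + 1/n`, is
unbounded; regrouping the weights exploits this gap in both directions.

For 1, take `j = 0` and `sᵢ² = 1/(i+1)`: the column weights are harmonic, so the sum norm is at most
1, while the average satisfies `G G* = h_n (e_{0,0} ⊗ 1)` and has norm of order `√h_n`.

For 2, take all `sᵢ² = 1/n!` and let `j` equal `k` on `n!/(k+1)` indices, for `k < n`: now the
average has harmonic weights and norm at most 1, while `C C*` is `1/n!` times a projection of rank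
`n! h_n`, so the column norm is of order `√h_n`.

The estimates are `weakNorm_two_le_one` from above, and `le_averageNorm_unitSeq` and
`le_colNorm_unitSeq` from below. -/

theorem sum_mul_of_orthogonal {R ι : Type*} [Ring R] [StarRing R] [DecidableEq ι] {p : ι → R}
    (hp : ∀ i, IsStarProjection (p i)) (horth : ∀ i j, i ≠ j → p i * p j = 0)
    (T : Finset ι) (j : ι) : (∑ i ∈ T, p i) * p j = if j ∈ T then p j else 0 := by
  rw [Finset.sum_mul]
  have : ∀ i ∈ T, p i * p j = if j = i then p j else 0 := by
    intro i _
    split_ifs with h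
    · subst h; exact (hp j).isIdempotentElem
    · exact horth i j (Ne.symm h)
  rw [Finset.sum_congr rfl this, Finset.sum_ite_eq]

theorem isStarProjection_sum {R ι : Type*} [Ring R] [StarRing R] {p : ι → R}
    (hp : ∀ i, IsStarProjection (p i)) (horth : ∀ i j, i ≠ j → p i * p j = 0)
    (T : Finset ι) : IsStarProjection (∑ i ∈ T, p i) := by
  classical
  refine ⟨?_, ?_⟩
  · change _ * _ = _
    conv_lhs => rw [Finset.mul_sum]
    refine Finset.sum_congr rfl fun j hj => ?_
    rw [sum_mul_of_orthogonal hp horth, if_pos hj]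
  · rw [IsSelfAdjoint, star_sum]
    exact Finset.sum_congr rfl fun j _ => (hp j).isSelfAdjoint

/-- A positive element has norm at most `r` exactly when it is dominated by `r • 1`, and a sum of
orthogonal projections is dominated by `1`. -/
theorem norm_sum_smul_le {R ι : Type*} [CStarAlgebra R] [PartialOrder R] [StarOrderedRing R]
    {p : ι → R} (hp : ∀ i, IsStarProjection (p i)) (horth : ∀ i j, i ≠ j → p i * p j = 0)
    (T : Finset ι) {w : ι → ℝ} {r : ℝ} (hr : 0 ≤ r) (hw : ∀ i ∈ T, 0 ≤ w i)
    (hwr : ∀ i ∈ T, w i ≤ r) : ‖∑ i ∈ T, w i • p i‖ ≤ r := by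
  rw [CStarAlgebra.norm_le_iff_le_algebraMap _ hr
    (Finset.sum_nonneg fun i hi => smul_nonneg (hw i hi) (hp i).nonneg)]
  calc ∑ i ∈ T, w i • p i ≤ ∑ i ∈ T, r • p i :=
        Finset.sum_le_sum fun i hi => smul_le_smul_of_nonneg_right (hwr i hi) (hp i).nonneg
    _ = r • ∑ i ∈ T, p i := Finset.smul_sum.symm
    _ ≤ r • 1 := smul_le_smul_of_nonneg_left (isStarProjection_sum hp horth T).le_one hr
    _ = algebraMap ℝ R r := (Algebra.algebraMap_eq_smul_one r).symm

end Projections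

/-! ### Two-sided estimates of the weak quasi-norm -/

section WeakNorm

variable {K : Type u} [NormedAddCommGroup K] [InnerProductSpace ℂ K] [CompleteSpace K]

theorem coe_isStarProjection {N : WeightedVNA K} {e : N.Elem} (he : IsStarProjection e) :
    IsStarProjection (e : K →L[ℂ] K) :=
  ⟨congrArg Subtype.val he.isIdempotentElem.eq, congrArg Subtype.val he.isSelfAdjoint.star_eq⟩

theorem isStarProjection_of_coe {N : WeightedVNA K} {e : N.Elem}
    (he : IsStarProjection (e : K →L[ℂ] K)) : IsStarProjection e :=
  ⟨Subtype.ext he.isIdempotentElem.eq, Subtype.ext he.isSelfAdjoint.star_eq⟩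

/-- The C*-identity: the singular numbers, defined by cutting on the left, depend only on `T T*`. -/
theorem norm_projection_mul_sq (e T : K →L[ℂ] K) (he : IsStarProjection e) :
    ‖e * T‖ ^ 2 = ‖e * (T * star T) * e‖ := by
  rw [sq, ← CStarRing.norm_self_mul_star, star_mul, he.isSelfAdjoint.star_eq]
  simp only [mul_assoc]

/-- If `T T* = ∑ⱼ wⱼ pⱼ` with orthogonal projections `pⱼ` of trace at most one and
`wⱼ ≤ 1 / (j + 1)`, then `‖T‖_{2,∞} ≤ 1`. -/
theorem weakNorm_two_le_one {N : WeightedVNA K} {T : N.Elem} {p : ℕ → N.Elem}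
    (hp : ∀ j, IsStarProjection (p j)) (horth : ∀ i j, i ≠ j → p i * p j = 0)
    (F : Finset ℕ) {w : ℕ → ℝ} (hw : ∀ j ∈ F, 0 ≤ w j) (hw' : ∀ j ∈ F, w j ≤ 1 / (j + 1))
    (hT : (T : K →L[ℂ] K) * star (T : K →L[ℂ] K) = ∑ j ∈ F, w j • (p j : K →L[ℂ] K))
    (htr : ∀ k : ℕ, N.tr (∑ j ∈ F with j < k, p j) ≤ k) :
    weakNorm 2 N T ≤ 1 := by
  refine iSup_le fun t => ?_
  -- Removing the projections of index below `⌊t⌋` costs trace at most `k ≤ t` and leaves weights at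
  -- most `1/(k+1)`. Since `t < k + 1`, the product `√t · √(1/(k+1))` is at most 1.
  set k := ⌊t⌋₊
  set P : N.Elem := ∑ j ∈ F with j < k, p j
  have hP : IsStarProjection P := isStarProjection_sum hp horth _
  have hk : (k : ℝ≥0) ≤ t := Nat.floor_le (zero_le)
  have hk' : t < k + 1 := Nat.lt_floor_add_one t
  have horth' : ∀ i j, i ≠ j → (p i : K →L[ℂ] K) * p j = 0 := fun i j h =>
    congrArg Subtype.val (horth i j h)
  have hmul : ∀ j ∈ F, (((1 - P : N.Elem) : K →L[ℂ] K) * p j)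
      = if k ≤ j then (p j : K →L[ℂ] K) else 0 := by
    intro j hj
    have h := congrArg Subtype.val (sum_mul_of_orthogonal hp horth (F.filter (· < k)) j)
    have h2 : ((1 - P : N.Elem) : K →L[ℂ] K) * p j = p j - ((P * p j : N.Elem) : K →L[ℂ] K) := by
      change (1 - (P : K →L[ℂ] K)) * p j = p j - (P : K →L[ℂ] K) * p j
      rw [sub_mul, one_mul]
    rw [h2, h]
    by_cases hjk : k ≤ j
    · simp [hjk]
    · simp [hj, hjk, not_le.1 hjk]
  have hsa : star ((1 - P : N.Elem) : K →L[ℂ] K) = ((1 - P : N.Elem) : K →L[ℂ] K) :=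
    (coe_isStarProjection hP.one_sub).isSelfAdjoint
  have hmul' : ∀ j ∈ F, ((p j : K →L[ℂ] K) * ((1 - P : N.Elem) : K →L[ℂ] K))
      = if k ≤ j then (p j : K →L[ℂ] K) else 0 := by
    intro j hj
    have h := congrArg star (hmul j hj)
    rw [star_mul, (coe_isStarProjection (hp j)).isSelfAdjoint.star_eq, hsa] at h
    rw [h]
    split_ifs
    · exact (coe_isStarProjection (hp j)).isSelfAdjoint
    · exact star_zero _
  have hnorm : ‖(((1 - P) * T : N.Elem) : K →L[ℂ] K)‖ ^ 2 ≤ 1 / (k + 1) := by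
    change ‖((1 - P : N.Elem) : K →L[ℂ] K) * (T : K →L[ℂ] K)‖ ^ 2 ≤ _
    rw [norm_projection_mul_sq _ _ (coe_isStarProjection hP.one_sub), hT]
    have : ((1 - P : N.Elem) : K →L[ℂ] K) * (∑ j ∈ F, w j • (p j : K →L[ℂ] K))
        * ((1 - P : N.Elem) : K →L[ℂ] K) = ∑ j ∈ F with k ≤ j, w j • (p j : K →L[ℂ] K) := by
      rw [Finset.mul_sum, Finset.sum_mul, Finset.sum_filter]
      refine Finset.sum_congr rfl fun j hj => ?_
      rw [mul_smul_comm, hmul j hj, smul_mul_assoc]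
      split_ifs with h
      · rw [hmul' j hj, if_pos h]
      · rw [zero_mul, smul_zero]
    rw [this]
    refine norm_sum_smul_le (fun j => coe_isStarProjection (hp j)) horth' _ (by positivity)
      (fun j hj => hw j (Finset.mem_filter.1 hj).1) fun j hj => ?_
    obtain ⟨hj, hkj⟩ := Finset.mem_filter.1 hj
    refine (hw' j hj).trans ?_
    gcongr
  have hsing : singularNumber N T t ≤ ‖(((1 - P) * T : N.Elem) : K →L[ℂ] K)‖ₑ := by
    refine iInf_le_of_le (1 - P) (iInf_le_of_le hP.one_sub (iInf_le_of_le ?_ le_rfl))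
    rw [sub_sub_cancel]
    exact (htr k).trans (by exact_mod_cast hk)
  refine (mul_le_mul_right hsing _).trans ?_
  set a := ‖(((1 - P) * T : N.Elem) : K →L[ℂ] K)‖ₑ with ha
  have ha2 : a ≤ ENNReal.ofReal √(1 / (k + 1)) := by
    rw [ha, ← ofReal_norm]
    exact ENNReal.ofReal_le_ofReal (Real.le_sqrt_of_sq_le hnorm)
  have ht2 : (t : ℝ≥0∞) ^ (1 / 2 : ℝ) = ENNReal.ofReal √t := by
    rw [← ENNReal.ofReal_coe_nnreal, ENNReal.ofReal_rpow_of_nonneg t.coe_nonneg (by norm_num),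
      Real.sqrt_eq_rpow]
  rw [ht2]
  refine (mul_le_mul_right ha2 _).trans ?_
  rw [← ENNReal.ofReal_mul (Real.sqrt_nonneg _), ← Real.sqrt_mul t.coe_nonneg,
    ENNReal.ofReal_le_one, Real.sqrt_le_iff, and_iff_right zero_le_one, one_pow, mul_one_div, div_le_one (by positivity)]
  exact_mod_cast hk'.le

theorem le_weakNorm_two {N : WeightedVNA K} {T : N.Elem} (t : ℝ≥0) {r : ℝ}
    (h : ∀ e : N.Elem, IsStarProjection e → N.tr (1 - e) ≤ t →
      r ≤ ‖(e : K →L[ℂ] K) * (T : K →L[ℂ] K)‖) :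
    ENNReal.ofReal (√t * r) ≤ weakNorm 2 N T := by
  refine le_iSup_of_le t ?_
  have ht2 : (t : ℝ≥0∞) ^ (1 / 2 : ℝ) = ENNReal.ofReal √t := by
    rw [← ENNReal.ofReal_coe_nnreal, ENNReal.ofReal_rpow_of_nonneg t.coe_nonneg (by norm_num),
      Real.sqrt_eq_rpow]
  rw [ht2, ENNReal.ofReal_mul (Real.sqrt_nonneg _)]
  refine mul_le_mul_right (le_iInf fun e => le_iInf fun he => le_iInf fun htr => ?_) _
  rw [← ofReal_norm]
  exact ENNReal.ofReal_le_ofReal (h e he htr)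

end WeakNorm

/-! ### Entries of elementary tensors -/

section Entries

variable {H : Type u} [NormedAddCommGroup H] [InnerProductSpace ℂ H] [CompleteSpace H]

theorem inner_basisVec (m n : ℕ) :
    inner ℂ (basisVec m) (basisVec n) = if m = n then (1 : ℂ) else 0 := by
  rw [basisVec, basisVec, lp.inner_single_left, lp.single_apply, Pi.single_apply]
  simp

theorem norm_basisVec (n : ℕ) : ‖basisVec n‖ = 1 := by
  rw [← sq_eq_sq₀ (norm_nonneg _) zero_le_one, ← @inner_self_eq_norm_sq ℂ, inner_basisVec]
  simp

theorem matrixUnit_apply_basisVec (m n k : ℕ) :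
    matrixUnit m n (basisVec k) = if n = k then basisVec m else 0 := by
  rw [matrixUnit, InnerProductSpace.rankOne_apply, inner_basisVec]
  split_ifs <;> simp

theorem matrixUnit_mul (m n k l : ℕ) :
    matrixUnit m n * matrixUnit k l = if n = k then matrixUnit m l else 0 := by
  change matrixUnit m n ∘L matrixUnit k l = _
  rw [matrixUnit, matrixUnit, InnerProductSpace.rankOne_comp_rankOne, inner_basisVec]
  split_ifs <;> simp [matrixUnit]

theorem star_matrixUnit (m n : ℕ) : star (matrixUnit m n) = matrixUnit n m := by
  rw [ContinuousLinearMap.star_eq_adjoint, matrixUnit, InnerProductSpace.adjoint_rankOne,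
    matrixUnit]

theorem isStarProjection_matrixUnit (n : ℕ) : IsStarProjection (matrixUnit n n) :=
  InnerProductSpace.isStarProjection_rankOne_self (norm_basisVec n)

theorem opTensor_zero_left (a : H →L[ℂ] H) : opTensor 0 a = 0 := by
  ext z
  induction z using UniformSpace.Completion.induction_on with
  | hp => exact isClosed_eq (by fun_prop) (by fun_prop)
  | ih z => rw [opTensor_coe, TensorProduct.mapL_zero_left, zero_apply, zero_apply,
      UniformSpace.Completion.coe_zero]

theorem opTensor_zero_right (x : Ell2 →L[ℂ] Ell2) : opTensor x (0 : H →L[ℂ] H) = 0 := by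
  ext z
  induction z using UniformSpace.Completion.induction_on with
  | hp => exact isClosed_eq (by fun_prop) (by fun_prop)
  | ih z => rw [opTensor_coe, TensorProduct.mapL_zero_right, zero_apply, zero_apply,
      UniformSpace.Completion.coe_zero]

theorem opTensor_smul_left (c : ℂ) (x : Ell2 →L[ℂ] Ell2) (a : H →L[ℂ] H) :
    opTensor (c • x) a = c • opTensor x a := by
  ext z
  induction z using UniformSpace.Completion.induction_on with
  | hp => exact isClosed_eq (opTensor (c • x) a).continuous (c • opTensor x a).continuous
  | ih z =>
    rw [smul_apply, opTensor_coe, opTensor_coe, TensorProduct.mapL_smul_left, smul_apply]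
    exact (UniformSpace.Completion.toComplL (𝕜 := ℂ) (E := Ell2 ⊗[ℂ] H)).map_smul c _

theorem isStarProjection_opTensor {x : Ell2 →L[ℂ] Ell2} {a : H →L[ℂ] H}
    (hx : IsStarProjection x) (ha : IsStarProjection a) : IsStarProjection (opTensor x a) := by
  refine ⟨?_, ?_⟩
  · rw [IsIdempotentElem, opTensor_mul, hx.isIdempotentElem.eq, ha.isIdempotentElem.eq]
  · rw [IsSelfAdjoint, star_opTensor, hx.isSelfAdjoint.star_eq, ha.isSelfAdjoint.star_eq]

theorem inner_slot (n : ℕ) (h : H) (v : Ell2) (g : H) :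
    inner ℂ (slot H n h) ((v ⊗ₜ[ℂ] g : Ell2 ⊗[ℂ] H) : Ell2Tensor H)
      = inner ℂ (basisVec n) v * inner ℂ h g := by
  rw [slot_apply, UniformSpace.Completion.inner_coe, TensorProduct.inner_tmul]

theorem norm_slot_apply (n : ℕ) (h : H) : ‖slot H n h‖ = ‖h‖ := by
  rw [← sq_eq_sq₀ (norm_nonneg _) (norm_nonneg _), ← @inner_self_eq_norm_sq ℂ,
    ← @inner_self_eq_norm_sq ℂ]
  rw [slot_apply n h, UniformSpace.Completion.inner_coe, TensorProduct.inner_tmul, inner_basisVec]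
  simp

theorem norm_slot_le (n : ℕ) : ‖slot H n‖ ≤ 1 :=
  ContinuousLinearMap.opNorm_le_bound _ zero_le_one fun h => by rw [norm_slot_apply, one_mul]

theorem opEntry_opTensor (x : Ell2 →L[ℂ] Ell2) (a : H →L[ℂ] H) (m n : ℕ) :
    opEntry (opTensor x a) m n = (inner ℂ (basisVec m) (x (basisVec n)) : ℂ) • a := by
  ext h
  refine ext_inner_left ℂ fun g => ?_
  rw [opEntry, ContinuousLinearMap.comp_apply, ContinuousLinearMap.adjoint_inner_right,
    ContinuousLinearMap.comp_apply, slot_apply n, opTensor_coe, TensorProduct.mapL_tmul, inner_slot,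
    smul_apply, inner_smul_right]

theorem opEntry_matrixUnit (a : H →L[ℂ] H) (k n : ℕ) :
    opEntry (opTensor (matrixUnit k k) a) n n = if n = k then a else 0 := by
  rw [opEntry_opTensor, matrixUnit_apply_basisVec]
  by_cases h : n = k
  · subst h; rw [if_pos rfl, if_pos rfl, inner_basisVec, if_pos rfl, one_smul]
  · simp [h, Ne.symm h]

theorem opEntry_sub (S T : Ell2Tensor H →L[ℂ] Ell2Tensor H) (m n : ℕ) :
    opEntry (S - T) m n = opEntry S m n - opEntry T m n := by
  ext h; simp [opEntry]

theorem opEntry_sum {ι : Type*} (F : Finset ι) (T : ι → Ell2Tensor H →L[ℂ] Ell2Tensor H) (m n : ℕ) :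
    opEntry (∑ i ∈ F, T i) m n = ∑ i ∈ F, opEntry (T i) m n := by
  ext h
  simp [opEntry]

theorem opEntry_one (n : ℕ) : opEntry (1 : Ell2Tensor H →L[ℂ] Ell2Tensor H) n n = 1 := by
  ext h
  refine ext_inner_left ℂ fun g => ?_
  rw [opEntry, ContinuousLinearMap.comp_apply, ContinuousLinearMap.adjoint_inner_right]
  change inner ℂ (slot H n g) (slot H n h) = inner ℂ g h
  rw [slot_apply n h, inner_slot, inner_basisVec, if_pos rfl, one_mul]

end Entries

/-! ### Sequences of weighted matrix units -/

section Sequences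

variable {H : Type u} [NormedAddCommGroup H] [InnerProductSpace ℂ H] [CompleteSpace H]

/-- The finite sequence `xᵢ = sᵢ e_{j(i),i}` for `i ∈ S`. -/
def unitSeq (S : Finset ℕ) (j : ℕ → ℕ) (s : ℕ → ℝ) : FinSeq :=
  Finsupp.onFinset S (fun i => if i ∈ S then (s i : ℂ) • matrixUnit (j i) i else 0)
    fun i hi => by by_contra h; exact hi (if_neg h)

theorem finiteRank_unitSeq (S : Finset ℕ) (j : ℕ → ℕ) (s : ℕ → ℝ) : (unitSeq S j s).FiniteRank := by
  intro n
  have hle : (unitSeq S j s n).range ≤ Submodule.span ℂ {basisVec (j n)} := by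
    rintro _ ⟨v, rfl⟩
    change (if n ∈ S then (s n : ℂ) • matrixUnit (j n) n else 0 : Ell2 →L[ℂ] Ell2) v ∈ _
    split_ifs
    · rw [smul_apply, matrixUnit, InnerProductSpace.rankOne_apply, smul_smul]
      exact Submodule.smul_mem _ _ (Submodule.mem_span_singleton_self _)
    · exact Submodule.zero_mem _
  exact Submodule.finiteDimensional_of_le hle

/-- The operator `∑ᵢ xᵢ ⊗ aᵢ` for `xᵢ = sᵢ e_{j(i),i}`. -/
def unitSeqOp (S : Finset ℕ) (j : ℕ → ℕ) (s : ℕ → ℝ) (a : ℕ → H →L[ℂ] H) :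
    Ell2Tensor H →L[ℂ] Ell2Tensor H :=
  ∑ i ∈ S, (s i : ℂ) • opTensor (matrixUnit (j i) i) (a i)

theorem coe_sum_elemTensor {N : WeightedVNA H} (S : Finset ℕ) (j : ℕ → ℕ) (s : ℕ → ℝ)
    (a : ℕ → N.Elem) :
    (((unitSeq S j s).sum fun n y => elemTensor y (a n) : (tensorAlg N).Elem) :
      Ell2Tensor H →L[ℂ] Ell2Tensor H) = unitSeqOp S j s fun i => (a i : H →L[ℂ] H) := by
  rw [unitSeq, Finsupp.onFinset_sum]
  · rw [AddSubmonoidClass.coe_finsetSum, unitSeqOp]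
    refine Finset.sum_congr rfl fun i hi => ?_
    rw [if_pos hi, ← opTensor_smul_left]
    rfl
  · exact fun i => Subtype.ext (opTensor_zero_left _)

/-- The second indices of the matrix units are distinct, so `e_{j(i),i} e_{k,j(k)} = 0` for `i ≠ k`,
whether or not `j` is injective. -/
theorem unitSeqOp_mul_star (S : Finset ℕ) (j : ℕ → ℕ) (s : ℕ → ℝ) (a : ℕ → H →L[ℂ] H) :
    unitSeqOp S j s a * star (unitSeqOp S j s a)
      = ∑ i ∈ S, (s i ^ 2) • opTensor (matrixUnit (j i) (j i)) (a i * star (a i)) := by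
  have hstar := star_sum (R := Ell2Tensor H →L[ℂ] Ell2Tensor H) S
    fun i => (s i : ℂ) • opTensor (matrixUnit (j i) i) (a i)
  rw [unitSeqOp, hstar, Finset.sum_mul]
  refine Finset.sum_congr rfl fun i hi => ?_
  rw [Finset.mul_sum, Finset.sum_eq_single i]
  · rw [star_smul, star_opTensor, star_matrixUnit, smul_mul_smul_comm, opTensor_mul, matrixUnit_mul,
      if_pos rfl, ← Complex.coe_smul]
    simp [sq]
  · intro k _ hk
    rw [star_smul, star_opTensor, star_matrixUnit, smul_mul_smul_comm, opTensor_mul, matrixUnit_mul,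
      if_neg hk.symm, opTensor_zero_left, smul_zero]
  · exact fun h => absurd hi h

theorem coe_colOp_unitSeq (S : Finset ℕ) (j : ℕ → ℕ) (s : ℕ → ℝ) :
    (colOp (unitSeq S j s) : Ell2Tensor Ell2 →L[ℂ] Ell2Tensor Ell2)
      = unitSeqOp S j s fun i => matrixUnit i 0 :=
  coe_sum_elemTensor (N := BEll2) S j s fun i => toBEll2 (matrixUnit i 0)

theorem coe_averageOp_unitSeq (A : NCProbSpace H) (ξ : ℕ → A.Elem) (S : Finset ℕ) (j : ℕ → ℕ)
    (s : ℕ → ℝ) : (averageOp A ξ (unitSeq S j s) : Ell2Tensor H →L[ℂ] Ell2Tensor H)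
      = unitSeqOp S j s fun i => (ξ i : H →L[ℂ] H) :=
  coe_sum_elemTensor (N := A.toWeighted) S j s ξ

end Sequences

/-! ### Traces -/

section Traces

variable {H : Type u} [NormedAddCommGroup H] [InnerProductSpace ℂ H] [CompleteSpace H]

/-- Replaces the diagonal entries by given elements of the algebra, so that the membership proofs
inside the trace do not obstruct rewriting. -/
theorem tensorAlg_tr_congr {N : WeightedVNA H} (T : (tensorAlg N).Elem) (b : ℕ → N.Elem)
    (h : ∀ n, opEntry (T : Ell2Tensor H →L[ℂ] Ell2Tensor H) n n = b n) :
    (tensorAlg N).tr T = ∑' n, N.tr (b n) :=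
  tsum_congr fun n => congrArg N.tr (Subtype.ext (h n))

theorem BEll2_tr_zero : BEll2.tr 0 = 0 := by
  change ∑' n, ENNReal.ofReal (inner ℂ (basisVec n) ((0 : Ell2 →L[ℂ] Ell2) (basisVec n))).re = 0
  simp

theorem BEll2_tr_sum_matrixUnit (F : Finset ℕ) :
    BEll2.tr (∑ i ∈ F, toBEll2 (matrixUnit i i)) = F.card := by
  have h : ∀ n, ENNReal.ofReal (inner ℂ (basisVec n)
      (((∑ i ∈ F, toBEll2 (matrixUnit i i) : BEll2.Elem) : Ell2 →L[ℂ] Ell2) (basisVec n))).re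
      = if n ∈ F then 1 else 0 := by
    intro n
    rw [AddSubmonoidClass.coe_finsetSum]
    change ENNReal.ofReal (inner ℂ (basisVec n) ((∑ i ∈ F, matrixUnit i i) (basisVec n))).re = _
    rw [sum_apply, inner_sum]
    have : ∀ i ∈ F, inner ℂ (basisVec n) (matrixUnit i i (basisVec n))
        = if n = i then (1 : ℂ) else 0 := by
      intro i _
      rw [matrixUnit_apply_basisVec]
      by_cases h : i = n
      · subst h; rw [if_pos rfl, inner_basisVec]
      · rw [if_neg h, inner_zero_right, if_neg (Ne.symm h)]
    rw [Finset.sum_congr rfl this, Finset.sum_ite_eq]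
    split_ifs <;> simp
  refine (tsum_congr h).trans ?_
  rw [tsum_eq_sum (s := F) fun n hn => if_neg hn, Finset.sum_congr rfl fun n hn => if_pos hn]
  simp

theorem tensorAlg_BEll2_tr_zero : (tensorAlg BEll2).tr 0 = 0 := by
  rw [tensorAlg_tr_congr 0 (fun _ => 0) fun n => by
    ext; simp [opEntry], BEll2_tr_zero, tsum_zero]

/-- The trace of a `WeightedVNA` is an arbitrary function: its value at `0` must be supplied for the
vanishing diagonal blocks, and the sum has to stay inside the trace. -/
theorem tensorAlg_tr_sum_single {N : WeightedVNA H} (hN : N.tr 0 = 0) (k : ℕ) {ι : Type*}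
    (F : Finset ι) (b : ι → N.Elem) :
    (tensorAlg N).tr (∑ i ∈ F, elemTensor (matrixUnit k k) (b i)) = N.tr (∑ i ∈ F, b i) := by
  rw [tensorAlg_tr_congr _ (fun n => if n = k then ∑ i ∈ F, b i else 0)]
  · rw [tsum_eq_single k fun n hn => by rw [if_neg hn, hN], if_pos rfl]
  · intro n
    rw [AddSubmonoidClass.coe_finsetSum, opEntry_sum]
    change ∑ i ∈ F, opEntry (opTensor (matrixUnit k k) (b i : H →L[ℂ] H)) n n = _
    simp only [opEntry_matrixUnit]
    split_ifs
    · rw [AddSubmonoidClass.coe_finsetSum]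
    · exact Finset.sum_const_zero

theorem toWeighted_tr_one (A : NCProbSpace H) : A.toWeighted.tr 1 = 1 := by
  change ENNReal.ofReal (A.τ 1).re = 1
  rw [A.map_one]; simp

theorem toWeighted_tr_zero (A : NCProbSpace H) : A.toWeighted.tr 0 = 0 := by
  change ENNReal.ofReal (A.τ 0).re = 0
  rw [map_zero]; simp

theorem tensorAlg_tr_sum_diagonal (A : NCProbSpace H) (F : Finset ℕ) :
    (tensorAlg A.toWeighted).tr (∑ i ∈ F, elemTensor (N := A.toWeighted) (matrixUnit i i) 1)
      = F.card := by
  rw [tensorAlg_tr_congr _ (fun n => if n ∈ F then 1 else 0)]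
  · have : ∀ n, A.toWeighted.tr (if n ∈ F then 1 else 0) = if n ∈ F then 1 else 0 := by
      intro n
      split_ifs
      · exact toWeighted_tr_one A
      · exact toWeighted_tr_zero A
    rw [tsum_congr this, tsum_eq_sum (s := F) fun n hn => if_neg hn,
      Finset.sum_congr rfl fun n hn => if_pos hn]
    simp
  · intro n
    rw [AddSubmonoidClass.coe_finsetSum, opEntry_sum]
    change ∑ i ∈ F, opEntry (opTensor (matrixUnit i i) (1 : H →L[ℂ] H)) n n = _
    simp only [opEntry_matrixUnit]
    rw [Finset.sum_ite_eq]
    split_ifs <;> rfl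

end Traces

/-! ### Upper estimates -/

section Upper

variable {H : Type u} [NormedAddCommGroup H] [InnerProductSpace ℂ H] [CompleteSpace H]

theorem card_filter_lt_le (F : Finset ℕ) (k : ℕ) : (F.filter (· < k)).card ≤ k := by
  refine (Finset.card_le_card fun i hi => ?_).trans_eq (Finset.card_range k)
  exact Finset.mem_range.2 (Finset.mem_filter.1 hi).2

/-- Here `C C* = ∑ sᵢ² e_{0,0} ⊗ e_{i,i}`, one weight for each rank-one projection. -/
theorem colNorm_unitSeq_le_one (S : Finset ℕ) {s : ℕ → ℝ} (hs : ∀ i ∈ S, s i ^ 2 ≤ 1 / (i + 1)) :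
    colNorm 2 (unitSeq S (fun _ => 0) s) ≤ 1 := by
  refine weakNorm_two_le_one
    (p := fun i => elemTensor (N := BEll2) (matrixUnit 0 0) (toBEll2 (matrixUnit i i)))
    (fun i => isStarProjection_of_coe (isStarProjection_opTensor (isStarProjection_matrixUnit 0)
      (isStarProjection_matrixUnit i))) ?_ S (fun i _ => sq_nonneg (s i)) hs ?_ ?_
  · intro i k hik
    refine Subtype.ext ?_
    change opTensor (matrixUnit 0 0) (matrixUnit i i)
      * opTensor (matrixUnit 0 0) (matrixUnit k k) = 0
    rw [opTensor_mul, matrixUnit_mul i, if_neg hik, opTensor_zero_right]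
  · rw [coe_colOp_unitSeq, unitSeqOp_mul_star]
    refine Finset.sum_congr rfl fun i _ => ?_
    rw [star_matrixUnit, matrixUnit_mul i 0 0 i, if_pos rfl]
    rfl
  · intro k
    rw [tensorAlg_tr_sum_single BEll2_tr_zero, BEll2_tr_sum_matrixUnit]
    exact_mod_cast card_filter_lt_le S k

theorem averageNorm_unitSeq_le_one (A : NCProbSpace H) {ξ : ℕ → A.Elem}
    (hξ : ∀ i, ξ i * star (ξ i) = 1) (S F : Finset ℕ) {j : ℕ → ℕ} (hj : ∀ i ∈ S, j i ∈ F)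
    {s : ℕ → ℝ}
    (hs : ∀ k ∈ F, ∑ i ∈ S with j i = k, s i ^ 2 ≤ 1 / (k + 1)) :
    averageNorm 2 A ξ (unitSeq S j s) ≤ 1 := by
  refine weakNorm_two_le_one
    (p := fun k => elemTensor (N := A.toWeighted) (matrixUnit k k) 1)
    (fun i => isStarProjection_of_coe (isStarProjection_opTensor (isStarProjection_matrixUnit i)
      (IsStarProjection.one _))) ?_ F (w := fun k => ∑ i ∈ S with j i = k, s i ^ 2)
      (fun k _ => Finset.sum_nonneg fun i _ => sq_nonneg (s i)) hs ?_ ?_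
  · intro i k hik
    refine Subtype.ext ?_
    change opTensor (matrixUnit i i) (1 : H →L[ℂ] H) * opTensor (matrixUnit k k) 1 = 0
    rw [opTensor_mul, matrixUnit_mul i, if_neg hik, opTensor_zero_left]
  -- As `ξᵢ ξᵢ* = 1`, every term with `j i = k` is a multiple of the same projection `e_{k,k} ⊗ 1`;
  -- the weights add up along the fibres of `j`.
  · rw [coe_averageOp_unitSeq, unitSeqOp_mul_star, ← Finset.sum_fiberwise_of_maps_to hj]
    refine Finset.sum_congr rfl fun k _ => ?_
    rw [Finset.sum_smul]
    refine Finset.sum_congr rfl fun i hi => ?_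
    have h1 : (ξ i : H →L[ℂ] H) * star (ξ i : H →L[ℂ] H) = 1 := congrArg Subtype.val (hξ i)
    rw [h1, (Finset.mem_filter.1 hi).2]
    rfl
  · intro k
    rw [tensorAlg_tr_sum_diagonal]
    exact_mod_cast card_filter_lt_le F k

theorem rowNorm_zero : rowNorm 2 0 = 0 := by
  refine le_antisymm (iSup_le fun t => ?_) zero_le
  have h : singularNumber (tensorAlg BEll2) (rowOp 0) t ≤ 0 := by
    refine iInf_le_of_le 1 (iInf_le_of_le (IsStarProjection.one _) (iInf_le_of_le ?_ ?_))
    · rw [sub_self, tensorAlg_BEll2_tr_zero]; exact zero_le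
    · rw [rowOp, Finsupp.sum_zero_index, mul_zero]
      exact enorm_zero.le
  rw [nonpos_iff_eq_zero.1 h, mul_zero]

theorem sumNorm_le_colNorm {x : FinSeq} (hx : x.FiniteRank) : sumNorm 2 x ≤ colNorm 2 x := by
  refine iInf_le_of_le 0 (iInf_le_of_le x (iInf_le_of_le (fun n => ?_) (iInf_le_of_le hx
    (iInf_le_of_le (zero_add x) ?_))))
  · have : ((0 : FinSeq) n).range = ⊥ := LinearMap.range_zero
    rw [this]; infer_instance
  · rw [rowNorm_zero, zero_add]

end Upper

/-! ### Lower estimates -/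

section Lower

variable {H : Type u} [NormedAddCommGroup H] [InnerProductSpace ℂ H] [CompleteSpace H]

/-- Whatever commutes with `T` commutes with its functional calculus; the bicommutant property
concludes. -/
theorem sqrt_mem_vonNeumannAlgebra {M : VonNeumannAlgebra H} {T : H →L[ℂ] H} (hT : T ∈ M) :
    CFC.sqrt T ∈ M := by
  rw [← SetLike.mem_coe, ← M.centralizer_centralizer]
  intro c hc
  have : Commute T c := hc T hT
  rw [CFC.sqrt_eq_cfc]
  exact (this.cfc_nnreal _).symm.eq

/-- Positivity of `τ` is given only on `star b * b` with `b` in the algebra, so the operator square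
root must be known to lie there. -/
theorem NCProbSpace.re_trace_nonneg (A : NCProbSpace H) {a : A.Elem} (ha : 0 ≤ (a : H →L[ℂ] H)) :
    0 ≤ (A.τ a).re := by
  let b : A.Elem := ⟨CFC.sqrt (a : H →L[ℂ] H), sqrt_mem_vonNeumannAlgebra (M := A.alg) a.2⟩
  have hb : star b * b = a := by
    refine Subtype.ext ?_
    change star (CFC.sqrt (a : H →L[ℂ] H)) * CFC.sqrt (a : H →L[ℂ] H) = a
    rw [(CFC.sqrt_nonneg (a : H →L[ℂ] H)).isSelfAdjoint.star_eq, CFC.sqrt_mul_sqrt_self _ ha]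
  have := A.nonneg b
  rw [hb] at this
  exact (Complex.nonneg_iff.1 this).1

theorem NCProbSpace.re_trace_le_norm (A : NCProbSpace H) {a : A.Elem} (ha : IsSelfAdjoint a) :
    (A.τ a).re ≤ ‖(a : H →L[ℂ] H)‖ := by
  have hsa : IsSelfAdjoint (a : H →L[ℂ] H) := congrArg Subtype.val ha
  have h := A.re_trace_nonneg (a := (‖(a : H →L[ℂ] H)‖ : ℂ) • 1 - a) (by
    have h1 := hsa.le_algebraMap_norm_self
    rw [Algebra.algebraMap_eq_smul_one, ← Complex.coe_smul] at h1
    exact sub_nonneg.2 h1)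
  rw [map_sub, map_smul, A.map_one] at h
  simpa using h

/-- Compression by the isometry `h ↦ e_n ⊗ h`, whose range is fixed by `e_{n,n} ⊗ 1`. -/
theorem norm_opEntry_le (e : Ell2Tensor H →L[ℂ] Ell2Tensor H) (n : ℕ) :
    ‖opEntry e n n‖ ≤ ‖e * opTensor (matrixUnit n n) 1‖ := by
  have hslot : opTensor (matrixUnit n n) (1 : H →L[ℂ] H) ∘L slot H n = slot H n := by
    ext h
    rw [ContinuousLinearMap.comp_apply, slot_apply, opTensor_coe, TensorProduct.mapL_tmul,
      matrixUnit_apply_basisVec, if_pos rfl]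
    rfl
  have hentry : opEntry e n n = ContinuousLinearMap.adjoint (slot H n)
      ∘L ((e * opTensor (matrixUnit n n) 1) ∘L slot H n) := by
    change _ = ContinuousLinearMap.adjoint (slot H n)
      ∘L (e ∘L (opTensor (matrixUnit n n) (1 : H →L[ℂ] H) ∘L slot H n))
    rw [hslot, opEntry]
  rw [hentry]
  refine (ContinuousLinearMap.opNorm_comp_le _ _).trans ?_
  rw [LinearIsometryEquiv.norm_map]
  refine (mul_le_of_le_one_left (norm_nonneg _) (norm_slot_le n)).trans ?_
  exact (ContinuousLinearMap.opNorm_comp_le _ _).trans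
    (mul_le_of_le_one_right (norm_nonneg _) (norm_slot_le n))

-- All the mass of `G G* = w p` lies on `p = e_{0,0} ⊗ 1`, of trace 1. If `tr(1 - e) ≤ 1/2`, the
-- `(0,0)` entry of `e` has trace, hence norm, at least `1/2`. So `‖eG‖ = √w ‖ep‖ ≥ √w/2`, and `t =
-- 1/2` gives `√(1/2) · √w/2 = √(w/8)`.
set_option synthInstance.maxHeartbeats 200000 in
theorem le_averageNorm_unitSeq (A : NCProbSpace H) {ξ : ℕ → A.Elem}
    (hξ : ∀ i, ξ i * star (ξ i) = 1) (S : Finset ℕ) (s : ℕ → ℝ) :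
    ENNReal.ofReal √((∑ i ∈ S, s i ^ 2) / 8) ≤ averageNorm 2 A ξ (unitSeq S (fun _ => 0) s) := by
  set w := ∑ i ∈ S, s i ^ 2 with hw
  have hw0 : 0 ≤ w := Finset.sum_nonneg fun i _ => sq_nonneg (s i)
  refine le_trans (ENNReal.ofReal_le_ofReal (le_of_eq ?_))
    (le_weakNorm_two (1 / 2) (r := √w / 2) fun e he htr => ?_)
  · rw [← Real.sqrt_sq (show (0 : ℝ) ≤ 2 by norm_num), ← Real.sqrt_div hw0,
      ← Real.sqrt_mul (by positivity)]
    congr 1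
    push_cast
    ring
  rw [coe_averageOp_unitSeq]
  set G := unitSeqOp S (fun _ => 0) s fun i => (ξ i : H →L[ℂ] H) with hG
  set p : Ell2Tensor H →L[ℂ] Ell2Tensor H := opTensor (matrixUnit 0 0) 1
  have hp : IsStarProjection p :=
    isStarProjection_opTensor (isStarProjection_matrixUnit 0) (IsStarProjection.one _)
  have he' := coe_isStarProjection he
  have hGG : G * star G = w • p := by
    rw [hG, unitSeqOp_mul_star, hw, Finset.sum_smul]
    refine Finset.sum_congr rfl fun i _ => ?_
    have h1 : (ξ i : H →L[ℂ] H) * star (ξ i : H →L[ℂ] H) = 1 := congrArg Subtype.val (hξ i)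
    rw [h1]
  set E : Ell2Tensor H →L[ℂ] Ell2Tensor H := (e : Ell2Tensor H →L[ℂ] Ell2Tensor H)
  have hnorm : ‖E * G‖ ^ 2 = w * ‖E * p‖ ^ 2 := by
    rw [norm_projection_mul_sq _ _ he', norm_projection_mul_sq _ _ he', hGG,
      hp.isSelfAdjoint.star_eq, hp.isIdempotentElem.eq, mul_smul_comm, smul_mul_assoc, norm_smul,
      Real.norm_of_nonneg hw0]
  let a : A.Elem := ⟨opEntry E 0 0, opEntry_mem A.alg e.2 0 0⟩
  have ha : IsSelfAdjoint a := by
    refine Subtype.ext ?_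
    change star (opEntry E 0 0) = opEntry E 0 0
    rw [ContinuousLinearMap.star_eq_adjoint, opEntry, ContinuousLinearMap.adjoint_comp,
      ContinuousLinearMap.adjoint_comp, ContinuousLinearMap.adjoint_adjoint,
      ← ContinuousLinearMap.star_eq_adjoint E, he'.isSelfAdjoint.star_eq,
      ContinuousLinearMap.comp_assoc]
  have htr0 : ENNReal.ofReal (A.τ (1 - a)).re ≤ ENNReal.ofReal (1 / 2) := by
    let b : A.Elem := 1 - a
    have hterm : A.toWeighted.tr b ≤ (tensorAlg A.toWeighted).tr (1 - e) := by
      -- Keep only the term `n = 0` of `∑ₙ τ((1 - e)_{n,n})`.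
      refine le_trans (le_of_eq (congrArg A.toWeighted.tr (Subtype.ext ?_))) (ENNReal.le_tsum 0)
      change 1 - opEntry E 0 0 = opEntry (1 - E) 0 0
      rw [opEntry_sub, opEntry_one]
    refine (hterm.trans htr).trans (le_of_eq ?_)
    rw [← ENNReal.ofReal_coe_nnreal]
    simp
  rw [ENNReal.ofReal_le_ofReal_iff (by norm_num), map_sub, A.map_one, Complex.sub_re,
    Complex.one_re] at htr0
  have h1 : 1 / 2 ≤ ‖E * p‖ := by
    have h2 := A.re_trace_le_norm ha
    have h3 : ‖(a : H →L[ℂ] H)‖ ≤ ‖E * p‖ := norm_opEntry_le E 0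
    linarith
  refine abs_le_of_sq_le_sq' ?_ (norm_nonneg _) |>.2
  rw [hnorm, div_pow, Real.sq_sqrt hw0]
  nlinarith [mul_le_mul_of_nonneg_left (show (1 / 4 : ℝ) ≤ ‖E * p‖ ^ 2 by nlinarith) hw0]

/-- The unit vectors `ζᵢ = e_{j(i)} ⊗ e_i` satisfy `C(e_i ⊗ e_0) = σ ζᵢ`. If `tr(1 - e) ≤ |S|/4`,
the mean of `‖(1 - e)ζᵢ‖²` is at most `1/4`, so some `i` has `‖eζᵢ‖ ≥ 1/2` and `‖eC‖ ≥ σ/2`. At `t =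
|S|/4` this gives `√(|S|/4) · σ/2 = √(|S| σ²/16)`. -/
theorem le_colNorm_unitSeq {S : Finset ℕ} (hS : S.Nonempty) (j : ℕ → ℕ) {σ : ℝ} (hσ : 0 ≤ σ) :
    ENNReal.ofReal √(S.card * σ ^ 2 / 16) ≤ colNorm 2 (unitSeq S j fun _ => σ) := by
  refine le_trans (ENNReal.ofReal_le_ofReal (le_of_eq ?_))
    (le_weakNorm_two (S.card / 4) (r := σ / 2) fun e he htr => ?_)
  · rw [← Real.sqrt_sq (show 0 ≤ σ / 2 by positivity), ← Real.sqrt_mul (by positivity)]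
    congr 1
    push_cast
    ring
  rw [coe_colOp_unitSeq]
  set G := unitSeqOp S j (fun _ => σ) fun i => matrixUnit i 0 with hG
  have he' := coe_isStarProjection he
  set E : Ell2Tensor Ell2 →L[ℂ] Ell2Tensor Ell2 := (e : Ell2Tensor Ell2 →L[ℂ] Ell2Tensor Ell2)
  let ζ : ℕ → Ell2Tensor Ell2 := fun i => slot Ell2 (j i) (basisVec i)
  have hζ : ∀ i, ‖ζ i‖ = 1 := fun i => by rw [norm_slot_apply, norm_basisVec]
  have hGζ : ∀ i ∈ S, G (slot Ell2 i (basisVec 0)) = (σ : ℂ) • ζ i := by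
    intro i hi
    rw [hG, unitSeqOp, sum_apply, Finset.sum_eq_single i]
    · rw [smul_apply, slot_apply, opTensor_coe, TensorProduct.mapL_tmul, matrixUnit_apply_basisVec,
        matrixUnit_apply_basisVec, if_pos rfl, if_pos rfl]
      rfl
    · intro k _ hk
      rw [smul_apply, slot_apply, opTensor_coe, TensorProduct.mapL_tmul, matrixUnit_apply_basisVec,
        if_neg hk, TensorProduct.zero_tmul, UniformSpace.Completion.coe_zero, smul_zero]
    · exact fun h => absurd hi h
  have hf : ∀ i, ‖(1 - E) (ζ i)‖ ^ 2
      = (inner ℂ (basisVec i) (opEntry (1 - E) (j i) (j i) (basisVec i))).re := by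
    intro i
    rw [opEntry, ContinuousLinearMap.comp_apply, ContinuousLinearMap.adjoint_inner_right,
      ContinuousLinearMap.comp_apply]
    change _ = (inner ℂ (ζ i) ((1 - E) (ζ i))).re
    have hfp := he'.one_sub
    conv_rhs => rw [← hfp.isIdempotentElem.eq, mul_apply_eq_comp,
      ← ContinuousLinearMap.adjoint_inner_left, ← ContinuousLinearMap.star_eq_adjoint,
      hfp.isSelfAdjoint.star_eq]
    exact (inner_self_eq_norm_sq (𝕜 := ℂ) _).symm
  have hsum : ∑ i ∈ S, ENNReal.ofReal (‖(1 - E) (ζ i)‖ ^ 2) ≤ (tensorAlg BEll2).tr (1 - e) := by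
    have h1 : (tensorAlg BEll2).tr (1 - e) = ∑' q : ℕ × ℕ, ENNReal.ofReal
        (inner ℂ (basisVec q.2) (opEntry (1 - E) q.1 q.1 (basisVec q.2))).re :=
      (ENNReal.tsum_prod (f := fun n m => ENNReal.ofReal
        (inner ℂ (basisVec m) (opEntry (1 - E) n n (basisVec m))).re)).symm
    rw [h1]
    -- The second coordinate keeps the `ζᵢ` at distinct places of the product basis even when `j`
    -- repeats values.
    have hinj : Function.Injective fun i => (j i, i) := fun a b h => (Prod.mk.inj h).2
    refine le_trans (le_of_eq ?_) (ENNReal.sum_le_tsum (S.map ⟨_, hinj⟩))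
    rw [Finset.sum_map]
    exact Finset.sum_congr rfl fun i _ => by rw [hf i]; rfl
  obtain ⟨i, hi, hi4⟩ : ∃ i ∈ S, ‖(1 - E) (ζ i)‖ ^ 2 ≤ 1 / 4 := by
    refine Finset.exists_le_of_sum_le hS ?_
    have := hsum.trans htr
    rw [← ENNReal.ofReal_sum_of_nonneg fun i _ => sq_nonneg _, ← ENNReal.ofReal_coe_nnreal,
      ENNReal.ofReal_le_ofReal_iff NNReal.zero_le_coe] at this
    refine this.trans (le_of_eq ?_)
    rw [Finset.sum_const, nsmul_eq_mul]
    push_cast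
    ring
  have hfi : ‖(1 - E) (ζ i)‖ ≤ 1 / 2 := by nlinarith [norm_nonneg ((1 - E) (ζ i))]
  have hE : 1 / 2 ≤ ‖E (ζ i)‖ := by
    have h1 : ζ i = E (ζ i) + (1 - E) (ζ i) := by
      rw [sub_apply, one_apply_eq_self]; abel
    have h2 := norm_add_le (E (ζ i)) ((1 - E) (ζ i))
    rw [← h1, hζ] at h2
    linarith
  have h3 := (E * G).le_opNorm (slot Ell2 i (basisVec 0))
  rw [norm_slot_apply, norm_basisVec, mul_one, mul_apply_eq_comp, hGζ i hi, map_smul, norm_smul,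
    Complex.norm_real, Real.norm_of_nonneg hσ] at h3
  nlinarith [mul_le_mul_of_nonneg_left hE hσ]

end Lower

/-! ### The counterexamples -/

section Counterexamples

variable {H : Type u} [NormedAddCommGroup H] [InnerProductSpace ℂ H] [CompleteSpace H]

theorem NCProbSpace.mul_star_eq_one_of_isFreeHaar_or_isRademacher (A : NCProbSpace H)
    {ξ : ℕ → A.Elem} (hξ : A.IsFreeHaar ξ ∨ A.IsRademacher ξ) (i : ℕ) : ξ i * star (ξ i) = 1 := by
  rcases hξ with h | h
  · exact (Unitary.mem_iff.1 (h.1 i).1).2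
  · rw [(h.1 i).1.star_eq, (h.1 i).2.1]

theorem exists_harmonic_gt (C : ℝ) : ∃ n : ℕ, C < ∑ k ∈ Finset.range n, 1 / ((k : ℝ) + 1) :=
  (Real.tendsto_sum_range_one_div_nat_succ_atTop.eventually_gt_atTop C).exists

theorem not_averageNorm_le_sumNorm (A : NCProbSpace H) {ξ : ℕ → A.Elem}
    (hξ : ∀ i, ξ i * star (ξ i) = 1) :
    ¬ ∃ c : ℝ≥0, ∀ x : FinSeq, x.FiniteRank → averageNorm 2 A ξ x ≤ c * sumNorm 2 x := by
  rintro ⟨c, hc⟩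
  -- The assumed bound would yield `√(h_n/8) ≤ c`.
  obtain ⟨n, hn⟩ := exists_harmonic_gt (8 * (c : ℝ) ^ 2)
  let s : ℕ → ℝ := fun i => √(1 / ((i : ℝ) + 1))
  have hs : ∀ i, s i ^ 2 = 1 / ((i : ℝ) + 1) := fun i => Real.sq_sqrt (by positivity)
  have hfr := finiteRank_unitSeq (Finset.range n) (fun _ => 0) s
  have h := (le_averageNorm_unitSeq A hξ (Finset.range n) s).trans ((hc _ hfr).trans
    (mul_le_mul_right ((sumNorm_le_colNorm hfr).trans
      (colNorm_unitSeq_le_one _ fun i _ => (hs i).le)) _))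
  rw [mul_one, ← ENNReal.ofReal_coe_nnreal, ENNReal.ofReal_le_ofReal_iff c.coe_nonneg,
    Real.sqrt_le_left c.coe_nonneg, Finset.sum_congr rfl fun i _ => hs i] at h
  linarith

/-- The disjoint union of the sets `{⟨k, l⟩ : l < n! / (k + 1)}` for `k < n`, coded by the pairing
function. -/
def harmonicBlocks (n : ℕ) : Finset ℕ :=
  (Finset.range n).biUnion fun k => (Finset.range (n.factorial / (k + 1))).image (Nat.pair k)

theorem mem_harmonicBlocks {n i : ℕ} : i ∈ harmonicBlocks n ↔
    (Nat.unpair i).1 < n ∧ (Nat.unpair i).2 < n.factorial / ((Nat.unpair i).1 + 1) := by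
  simp only [harmonicBlocks, Finset.mem_biUnion, Finset.mem_range, Finset.mem_image]
  constructor
  · rintro ⟨k, hk, l, hl, rfl⟩
    simpa using ⟨hk, hl⟩
  · rintro ⟨h1, h2⟩
    exact ⟨_, h1, _, h2, Nat.pair_unpair i⟩

theorem card_harmonicBlocks_fiber {n k : ℕ} (hk : k < n) :
    ((harmonicBlocks n).filter fun i => (Nat.unpair i).1 = k).card = n.factorial / (k + 1) := by
  have : (harmonicBlocks n).filter (fun i => (Nat.unpair i).1 = k)
      = (Finset.range (n.factorial / (k + 1))).image (Nat.pair k) := by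
    ext i
    simp only [Finset.mem_filter, mem_harmonicBlocks, Finset.mem_image, Finset.mem_range]
    constructor
    · rintro ⟨⟨_, h2⟩, rfl⟩
      exact ⟨_, h2, Nat.pair_unpair i⟩
    · rintro ⟨l, hl, rfl⟩
      simpa using ⟨hk, hl⟩
  rw [this, Finset.card_image_of_injective _ fun a b h => (Nat.pair_eq_pair.1 h).2,
    Finset.card_range]

/-- For `k < n` the number `k + 1` divides `n!`, so the natural-number division is exact and equal
weights `1/n!` add up to exactly `1/(k+1)`. -/
theorem cast_card_harmonicBlocks_fiber {n k : ℕ} (hk : k < n) :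
    (((harmonicBlocks n).filter fun i => (Nat.unpair i).1 = k).card : ℝ) * (1 / n.factorial)
      = 1 / (k + 1) := by
  rw [card_harmonicBlocks_fiber hk, Nat.cast_div (Nat.dvd_factorial k.succ_pos hk) (by positivity)]
  have : (n.factorial : ℝ) ≠ 0 := by positivity
  push_cast
  field_simp

theorem not_interNorm_le_averageNorm (A : NCProbSpace H) {ξ : ℕ → A.Elem}
    (hξ : ∀ i, ξ i * star (ξ i) = 1) :
    ¬ ∃ c : ℝ≥0, ∀ x : FinSeq, x.FiniteRank → interNorm 2 x ≤ c * averageNorm 2 A ξ x := by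
  rintro ⟨c, hc⟩
  -- The assumed bound would yield `√(h_n/16) ≤ c`, since `|S| σ² = h_n`.
  obtain ⟨n, hn⟩ := exists_harmonic_gt (16 * (c : ℝ) ^ 2)
  let S := harmonicBlocks n
  let j : ℕ → ℕ := fun i => (Nat.unpair i).1
  have hj : ∀ i ∈ S, j i ∈ Finset.range n := fun i hi =>
    Finset.mem_range.2 (mem_harmonicBlocks.1 hi).1
  let σ : ℝ := √(1 / n.factorial)
  have hσ : σ ^ 2 = 1 / n.factorial := Real.sq_sqrt (by positivity)
  have hcard : (S.card : ℝ) * σ ^ 2 = ∑ k ∈ Finset.range n, 1 / ((k : ℝ) + 1) := by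
    rw [Finset.card_eq_sum_card_fiberwise hj, hσ]
    push_cast
    rw [Finset.sum_mul]
    exact Finset.sum_congr rfl fun k hk => cast_card_harmonicBlocks_fiber (Finset.mem_range.1 hk)
  have hS : S.Nonempty := by
    rw [Finset.nonempty_iff_ne_empty]
    intro h
    rw [h, Finset.card_empty, Nat.cast_zero, zero_mul] at hcard
    nlinarith [sq_nonneg (c : ℝ)]
  have havg : averageNorm 2 A ξ (unitSeq S j fun _ => σ) ≤ 1 := by
    refine averageNorm_unitSeq_le_one A hξ S (Finset.range n) hj fun k hk => ?_
    rw [Finset.sum_const, nsmul_eq_mul, hσ]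
    exact (cast_card_harmonicBlocks_fiber (Finset.mem_range.1 hk)).le
  have h := (le_colNorm_unitSeq hS j (Real.sqrt_nonneg _)).trans ((le_max_right _ _).trans
    ((hc _ (finiteRank_unitSeq S j fun _ => σ)).trans (mul_le_mul_right havg _)))
  rw [mul_one, ← ENNReal.ofReal_coe_nnreal, ENNReal.ofReal_le_ofReal_iff c.coe_nonneg,
    Real.sqrt_le_left c.coe_nonneg, hcard] at h
  linarith

end Counterexamples

end NCKhintchine

end

theorem proposition1p2 {H : Type*} [NormedAddCommGroup H] [InnerProductSpace ℂ H]
    [CompleteSpace H] (A : NCKhintchine.NCProbSpace H) (ξ : ℕ → A.Elem)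
    (hξ : A.IsFreeHaar ξ ∨ A.IsRademacher ξ) :
    (¬ ∃ c : ℝ≥0, ∀ x : NCKhintchine.FinSeq, x.FiniteRank →
      NCKhintchine.averageNorm 2 A ξ x ≤ c * NCKhintchine.sumNorm 2 x) ∧
    (¬ ∃ c : ℝ≥0, ∀ x : NCKhintchine.FinSeq, x.FiniteRank →
      NCKhintchine.interNorm 2 x ≤ c * NCKhintchine.averageNorm 2 A ξ x) :=
  have h := A.mul_star_eq_one_of_isFreeHaar_or_isRademacher hξ
  ⟨NCKhintchine.not_averageNorm_le_sumNorm A h, NCKhintchine.not_interNorm_le_averageNorm A h⟩
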